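/- Let $E_{2n}=S\cup T$ be a $2n$-element set, partitioned into two $n$-element sets $S,T$, with an involution $e\mapsto\overline e$ that maps $S$ onto $T$. For $F\subseteq E_{2n}$ put $\overline F=\{\overline e:e\in F\}$, and call $F$ complementary if $F\cap\overline F=\emptyset$. All oriented matroids $\mathcal M$ on $E_{2n}$ are given by their sets of vectors; circuits are the nonzero vectors of inclusion-minimal support, and bases are the inclusion-maximal sets containing no support of a circuit. For a basis $B$ and $e\notin B$, $C(B,e)$ is the unique circuit with support in $B\cup\{e\}$ and sign $+$ at $e$. Let $\mathcal M$ be an oriented matroid on $E_{2n}$ of which $S$ is a basis. It is a P-matroid if it has no circuit $C$ with $C_e\cdot C_{\overline e}\le 0$ for all $e\in S$. It has the Z-property with respect to a set $S'$ if every circuit $C$ with $C_{\overline{S'}}\ge 0$ satisfies $C_{\overline e}=+$ for all $e\in S'$ with $C_e=+$. It is a K-matroid if it is a P-matroid with the Z-property with respect to $S$, and a K*-matroid if it is a P-matroid with the Z-property with respect to some complementary set $S'$ of cardinality $n$. The principal pivot transform of an oriented matroid on $E_{2n}$ with respect to a complementary set $F$ is obtained by exchanging, in every vector, the entries at $e$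 and $\overline e$ for all $e\in F$. (1) The class of K*-matroids on $E_{2n}$ is the closure of the class of K-matroids on $E_{2n}$ under all principal pivot transforms. (2) Let $\mathcal M$ be a K*-matroid on $E_{2n}$ and let $\hat{\mathcal M}$ be a one-point extension of $\mathcal M$, that is, an oriented matroid on $E_{2n}\cup\{q\}$, $q\notin E_{2n}$, whose deletion of $q$ is $\mathcal M$ and which has a vector that is nonzero at $q$. A solution of OMCP$(\hat{\mathcal M})$ is a vector $X\ge 0$ of $\hat{\mathcal M}$ with $X_q=+$ and $X_e\cdot X_{\overline e}=0$ for all $e\in E_{2n}$. A simple principal pivot algorithm starts with any basis $B^0\subseteq E_{2n}$ of $\hat{\mathcal M}$ that is complementary and with $C^0=C(B^0,q)$; as long as $C^i$ has a negative entry, it chooses by an arbitrary pivot rule (which may depend on the whole history) an element $e^i$ with $C^i_{e^i}=-$, and performs the pivot step $B^{i+1}=(B^i\setminus\{e^i\})\cup\{\overline{e^i}\}$, $C^{i+1}=C(B^{i+1},q)$; when $C^i$ has no negative entry it stops and returns $C^i$. Then, for every complementary starting basis $B^0$ and every pivot rule, the algorithm stops after at most $2n$ pivot steps, and the returned circuit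 is the unique solution of OMCP$(\hat{\mathcal M})$. -/

import Mathlib

/-- A sign vector on `E`: a vector with entries in `{+, 0, -}`. -/
abbrev SignVec (E : Type*) := E → SignType

namespace SignVec

variable {E : Type*}

/-- The support of a sign vector. -/
def supp (X : SignVec E) : Set E := {e | X e ≠ 0}

/-- The composition `X ∘ Y`. -/
def comp (X Y : SignVec E) : SignVec E := fun e => if X e ≠ 0 then X e else Y e

end SignVec

/-- An oriented matroid on `E`, given by its set of vectors. -/
structure OrientedMatroid (E : Type*) where
  vectors : Set (SignVec E)
  zero_mem : (0 : SignVec E) ∈ vectors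
  neg_mem : ∀ X ∈ vectors, -X ∈ vectors
  comp_mem : ∀ X ∈ vectors, ∀ Y ∈ vectors, SignVec.comp X Y ∈ vectors
  /-- Vector elimination of `X` and `Y` at `e`. -/
  elim : ∀ X ∈ vectors, ∀ Y ∈ vectors, ∀ e, X e = 1 → Y e = -1 →
    ∃ Z ∈ vectors,
      (∀ f, Z f = 1 → X f = 1 ∨ Y f = 1) ∧
      (∀ f, Z f = -1 → X f = -1 ∨ Y f = -1) ∧
      Z e = 0 ∧
      (∀ f, (X f ≠ 0 ∧ Y f = 0) ∨ (Y f ≠ 0 ∧ X f = 0) ∨ (X f = 1 ∧ Y f = 1) ∨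
        (X f = -1 ∧ Y f = -1) → Z f ≠ 0)

namespace OrientedMatroid

variable {E : Type*}

/-- A circuit: a nonzero vector of inclusion-minimal support. -/
def IsCircuit (M : OrientedMatroid E) (C : SignVec E) : Prop :=
  C ∈ M.vectors ∧ C ≠ 0 ∧ ¬ ∃ X ∈ M.vectors, X ≠ 0 ∧ X.supp ⊂ C.supp

/-- A basis: an inclusion-maximal set that contains the support of no circuit. -/
def IsBasis (M : OrientedMatroid E) (B : Set E) : Prop :=
  Maximal (fun A : Set E => ∀ C, M.IsCircuit C → ¬ C.supp ⊆ A) B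

/-- `C` is a fundamental circuit `C(B, e)`. -/
def IsFundamentalCircuit (M : OrientedMatroid E) (B : Set E) (e : E) (C : SignVec E) : Prop :=
  M.IsCircuit C ∧ C.supp ⊆ insert e B ∧ C e = 1

open Classical in
/-- The oracle: for a basis `B` and a nonbasic element `e` it outputs the fundamental circuit
`C(B, e)`. An illegal query is answered by the zero sign vector, which is not a circuit. -/
noncomputable def fundamentalCircuit (M : OrientedMatroid E) (B : Set E) (e : E) : SignVec E :=
  if h : M.IsBasis B ∧ e ∉ B ∧ ∃ C, M.IsFundamentalCircuit B e C then h.2.2.choose else 0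

/-- The oriented matroid whose vectors are the `X ∘ σ⁻¹` for `X` a vector of `M`. -/
def relabel (M : OrientedMatroid E) (σ : Equiv.Perm E) : OrientedMatroid E where
  vectors := {X | (fun e => X (σ e)) ∈ M.vectors}
  zero_mem := M.zero_mem
  neg_mem := fun X hX => M.neg_mem _ hX
  comp_mem := fun X hX Y hY => M.comp_mem _ hX _ hY
  elim := by
    intro X hX Y hY e hXe hYe
    obtain ⟨Z, hZ, h1, h2, h3, h4⟩ :=
      M.elim _ hX _ hY (σ.symm e) (by simpa using hXe) (by simpa using hYe)
    refine ⟨fun f => Z (σ.symm f), by simpa using hZ, ?_, ?_, h3, ?_⟩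
    · intro f hf; simpa using h1 _ hf
    · intro f hf; simpa using h2 _ hf
    · intro f hf; exact h4 (σ.symm f) (by simpa using hf)

/-- `Mhat`, on `E ∪ {q}` with `q = none`, is a one-point extension of `M`: deleting `q` from `Mhat`
gives `M`, and some vector of `Mhat` is nonzero at `q`. -/
def IsOnePointExtension (Mhat : OrientedMatroid (Option E)) (M : OrientedMatroid E) : Prop :=
  M.vectors = {Y | ∃ X ∈ Mhat.vectors, X none = 0 ∧ Y = fun e => X (some e)} ∧
    ∃ X ∈ Mhat.vectors, X none ≠ 0

end OrientedMatroid

/-- The structure of a `2n`-element set `E = S ∪ T` with complementation `e ↦ compl e`. -/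
structure ComplementedSet (E : Type*) (n : ℕ) where
  S : Set E
  T : Set E
  union_eq : S ∪ T = Set.univ
  disj : Disjoint S T
  card_S : S.ncard = n
  card_T : T.ncard = n
  compl : E → E
  compl_compl : ∀ e, compl (compl e) = e
  compl_mem : ∀ e ∈ S, compl e ∈ T

namespace ComplementedSet

variable {E : Type*} {n : ℕ} (G : ComplementedSet E n)

/-- `F` contains no element together with its complement. -/
def IsComplementary (F : Set E) : Prop := Disjoint F (G.compl '' F)

/-- `X` is sign-reversing. -/
def SignReversing (X : SignVec E) : Prop := ∀ e ∈ G.S, X e * X (G.compl e) ≤ 0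

/-- P-matroid: `S` is a basis (as for all matroids considered on `E = S ∪ T`) and there is no
sign-reversing circuit. -/
def IsPMatroid (M : OrientedMatroid E) : Prop :=
  M.IsBasis G.S ∧ ¬ ∃ C, M.IsCircuit C ∧ G.SignReversing C

/-- The Z-property of `M` with respect to a set `S'`, with `T' = compl '' S'`. -/
def ZProperty (M : OrientedMatroid E) (S' : Set E) : Prop :=
  ∀ C, M.IsCircuit C → (∀ f ∈ G.compl '' S', 0 ≤ C f) →
    ∀ e ∈ S', C e = 1 → C (G.compl e) = 1

/-- Z-matroid: the Z-property holds with respect to the fixed set `S`. -/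
def IsZMatroid (M : OrientedMatroid E) : Prop :=
  M.IsBasis G.S ∧ G.ZProperty M G.S

/-- Z*-matroid: the Z-property holds with respect to some complementary `n`-element set. -/
def IsZStarMatroid (M : OrientedMatroid E) : Prop :=
  M.IsBasis G.S ∧ ∃ S' : Set E, G.IsComplementary S' ∧ S'.ncard = n ∧ G.ZProperty M S'

/-- K-matroid. -/
def IsKMatroid (M : OrientedMatroid E) : Prop := G.IsPMatroid M ∧ G.IsZMatroid M

/-- K*-matroid. -/
def IsKStarMatroid (M : OrientedMatroid E) : Prop := G.IsPMatroid M ∧ G.IsZStarMatroid M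

open Classical in
/-- The permutation of `E` that exchanges `e` and `compl e` for every `e ∈ F`. -/
noncomputable def exchange (F : Set E) : Equiv.Perm E :=
  Function.Involutive.toPerm
    (fun e => if e ∈ F ∨ G.compl e ∈ F then G.compl e else e)
    (by
      intro e
      by_cases h : e ∈ F ∨ G.compl e ∈ F
      · have h' : G.compl e ∈ F ∨ e ∈ F := h.symm
        simp [h, h', G.compl_compl]
      · simp [h])

/-- The principal pivot transform of `M` with respect to `F`: in every vector the entries at `e`
and `compl e` are exchanged for every `e ∈ F`. -/
noncomputable def principalPivot (F : Set E) (M : OrientedMatroid E) : OrientedMatroid E :=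
  M.relabel (G.exchange F)

/-- The closure of a class `P` of matroids under all principal pivot transforms. -/
inductive PrincipalPivotClosure (P : OrientedMatroid E → Prop) : OrientedMatroid E → Prop
  | base (M : OrientedMatroid E) (hM : P M) : PrincipalPivotClosure P M
  | pivot (M : OrientedMatroid E) (F : Set E) (hF : G.IsComplementary F)
      (hM : PrincipalPivotClosure P M) : PrincipalPivotClosure P (G.principalPivot F M)

/-- `X` is a solution of the complementarity problem OMCP(`Mhat`). -/
def IsSolution (Mhat : OrientedMatroid (Option E)) (X : SignVec (Option E)) : Prop :=
  X ∈ Mhat.vectors ∧ (∀ e, 0 ≤ X e) ∧ X none = 1 ∧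
    ∀ e : E, X (some e) * X (some (G.compl e)) = 0

end ComplementedSet

/-- The state of a simple principal pivot algorithm: the earlier pairs `(Bʲ, Cʲ)` (latest first),
the current basis `Bⁱ` and the current circuit `Cⁱ`. -/
structure PivotState (E : Type*) where
  past : List (Set E × SignVec (Option E))
  basis : Set E
  circuit : SignVec (Option E)

/-- A pivot rule chooses, possibly depending on the whole history, an element at which the current
circuit is negative, whenever there is one. -/
def PivotRule (E : Type*) :=
  (s : PivotState E) → (∃ e : E, s.circuit (some e) = -1) → {e : E // s.circuit (some e) = -1}

namespace ComplementedSet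

variable {E : Type*} {n : ℕ} (G : ComplementedSet E n)

/-- The initial state: basis `B⁰` and circuit `C(B⁰, q)`. -/
noncomputable def initState (Mhat : OrientedMatroid (Option E)) (B₀ : Set E) : PivotState E where
  past := []
  basis := B₀
  circuit := Mhat.fundamentalCircuit (some '' B₀) none

/-- One pivot step: in the basis, `e` is replaced by its complement; then the oracle is asked for
the new circuit. -/
noncomputable def pivotStep (Mhat : OrientedMatroid (Option E)) (s : PivotState E) (e : E) :
    PivotState E where
  past := (s.basis, s.circuit) :: s.past
  basis := insert (G.compl e) (s.basis \ {e})
  circuit := Mhat.fundamentalCircuit (some '' insert (G.compl e) (s.basis \ {e})) none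

/-- `G.Returns Mhat R s k C`: the simple principal pivot algorithm with pivot rule `R`, run from the
state `s`, performs exactly `k` pivot steps, then stops and returns `C`. -/
inductive Returns (Mhat : OrientedMatroid (Option E)) (R : PivotRule E) :
    PivotState E → ℕ → SignVec (Option E) → Prop
  | halt (s : PivotState E) (h : ∀ e, s.circuit e ≠ -1) : Returns Mhat R s 0 s.circuit
  | step (s : PivotState E) (h : ∃ e : E, s.circuit (some e) = -1) (k : ℕ) (C : SignVec (Option E))
      (hr : Returns Mhat R (G.pivotStep Mhat s (R s h)) k C) : Returns Mhat R s (k + 1) C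

end ComplementedSet

/-! Write `T'` for the complement of `S'`. By conformal decomposition the P-property passes from
circuits to vectors: a sign-reversing vector is zero. Hence every transversal of the complementary
pairs is a basis, OMCP has at most one solution, and pivoting on a pair never leaves the bases.

For (1), exchanging the pairs met by `S' \ S` carries `S'` to `S`. Exchanges commute with
complementation, so they preserve the P-property and transport the Z-property; each is its own
inverse.

For (2), let `X` and `Y` be the fundamental circuits of `q` before and after a pivot at `e`.
Eliminating `q` between `Y` and `-X` gives a vector `Z` of the P-matroid whose only complementary
pair in the support is that of `e`. Since `Z` is positive at `e`, the P-property makes it positive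
at the complement of `e`, and so is `Y`: an entering element is positive. The Z-property, through
`IsPMatroid.nonneg_of_zProperty`, makes `Z` nonnegative on `T'`; an entry of `X` positive on `T'`
thus stays positive in `Y` (`IsPMatroid.pivot_sign`).

So once an element of `T'` has entered the basis it remains positive and is never pivoted out. Each
pair is pivoted at most twice: its element of `T'` may leave once and enter once. The potential 2,
1, 0 of a pair records these stages and gives the bound `2 * n`. -/

namespace SignVec

variable {E : Type*}

/-- `X` is conformal to `Y`: it vanishes or agrees with `Y` at every element. -/
def Conforms (X Y : SignVec E) : Prop := ∀ e, X e = 0 ∨ X e = Y e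

theorem Conforms.trans {X Y Z : SignVec E} (h : X.Conforms Y) (h' : Y.Conforms Z) :
    X.Conforms Z := by
  intro e
  rcases h e with h | h
  · exact Or.inl h
  · rw [h]; exact h' e

end SignVec

theorem SignType.eq_or_eq_neg_of_ne_zero {a b : SignType} (ha : a ≠ 0) (hb : b ≠ 0) :
    b = a ∨ b = -a := by
  revert a b; decide

/-! ### Elimination, conformal circuits and basis exchange -/

namespace OrientedMatroid

variable {E : Type*} {M : OrientedMatroid E}

/-- Vector elimination, in a form that is symmetric in the two signs. -/
theorem exists_elim {X Y : SignVec E} (hX : X ∈ M.vectors) (hY : Y ∈ M.vectors) {e : E}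
    (hXe : X e ≠ 0) (hYe : Y e = -X e) :
    ∃ Z ∈ M.vectors, Z e = 0 ∧ (∀ f, Z f = 0 ∨ Z f = X f ∨ Z f = Y f) ∧
      (∀ f, Y f = 0 → Z f = X f) ∧ (∀ f, X f = 0 → Z f = Y f) ∧
      (∀ f, X f = Y f → Z f = X f) := by
  have key : ∃ Z ∈ M.vectors, (∀ f, Z f = 1 → X f = 1 ∨ Y f = 1) ∧
      (∀ f, Z f = -1 → X f = -1 ∨ Y f = -1) ∧ Z e = 0 ∧
      (∀ f, (X f ≠ 0 ∧ Y f = 0) ∨ (Y f ≠ 0 ∧ X f = 0) ∨ (X f = 1 ∧ Y f = 1) ∨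
        (X f = -1 ∧ Y f = -1) → Z f ≠ 0) := by
    rcases SignType.trichotomy (X e) with h | h | h
    · obtain ⟨Z, hZ, h1, h2, h3, h4⟩ := M.elim Y hY X hX e (by rw [hYe, h]; rfl) h
      refine ⟨Z, hZ, fun f hf => (h1 f hf).symm, fun f hf => (h2 f hf).symm, h3, fun f hf => ?_⟩
      apply h4; tauto
    · exact absurd h hXe
    · exact M.elim X hX Y hY e h (by rw [hYe, h])
  obtain ⟨Z, hZ, h1, h2, h3, h4⟩ := key
  have dec : ∀ x y z : SignType, (z = 1 → x = 1 ∨ y = 1) → (z = -1 → x = -1 ∨ y = -1) →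
      ((x ≠ 0 ∧ y = 0) ∨ (y ≠ 0 ∧ x = 0) ∨ (x = 1 ∧ y = 1) ∨ (x = -1 ∧ y = -1) → z ≠ 0) →
      (z = 0 ∨ z = x ∨ z = y) ∧ (y = 0 → z = x) ∧ (x = 0 → z = y) ∧ (x = y → z = x) := by
    decide
  have h := fun f => dec (X f) (Y f) (Z f) (h1 f) (h2 f) (h4 f)
  exact ⟨Z, hZ, h3, fun f => (h f).1, fun f => (h f).2.1, fun f => (h f).2.2.1,
    fun f => (h f).2.2.2⟩

/-- Elimination with control of the supports only. -/
theorem exists_elim_supp {X Y : SignVec E} (hX : X ∈ M.vectors) (hY : Y ∈ M.vectors) {e : E}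
    (hXe : X e ≠ 0) (hYe : Y e ≠ 0) :
    ∃ Z ∈ M.vectors, Z e = 0 ∧ (∀ f, Z f ≠ 0 → X f ≠ 0 ∨ Y f ≠ 0) ∧
      (∀ f, Y f = 0 → Z f = X f) ∧ (∀ f, X f = 0 → Y f ≠ 0 → Z f ≠ 0) := by
  rcases SignType.eq_or_eq_neg_of_ne_zero hXe hYe with h | h
  · obtain ⟨Z, hZ, h0, h1, h2, h3, -⟩ := M.exists_elim hX (M.neg_mem Y hY) hXe
      (by rw [Pi.neg_apply, h])
    refine ⟨Z, hZ, h0, fun f hf => ?_, fun f hf => h2 f (by simp [hf]), fun f hf hf' => ?_⟩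
    · rcases h1 f with h | h | h
      · exact absurd h hf
      · exact Or.inl (h ▸ hf)
      · refine Or.inr fun h' => hf ?_
        rw [h, Pi.neg_apply, h', neg_zero]
    · rw [h3 f hf]; simpa using hf'
  · obtain ⟨Z, hZ, h0, h1, h2, h3, -⟩ := M.exists_elim hX hY hXe h
    refine ⟨Z, hZ, h0, fun f hf => ?_, h2, fun f hf hf' => ?_⟩
    · rcases h1 f with h | h | h
      · exact absurd h hf
      · exact Or.inl (h ▸ hf)
      · exact Or.inr (h ▸ hf)
    · rw [h3 f hf]; exact hf'

/-- Eliminating between `X` and `W` at an element where their signs are opposite creates no new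
disagreement with `X` and removes that one. The induction is on the number `k` of disagreements. -/
theorem exists_conforms_of_ssubset [Finite E] {X : SignVec E} (hX : X ∈ M.vectors) (k : ℕ) :
    ∀ W ∈ M.vectors, W ≠ 0 → W.supp ⊂ X.supp → {f | W f ≠ 0 ∧ W f ≠ X f}.ncard = k →
      ∃ Y ∈ M.vectors, Y ≠ 0 ∧ Y.supp ⊂ X.supp ∧ Y.Conforms X := by
  induction k using Nat.strong_induction_on with
  | _ k ih =>
    intro W hW hW0 hs hk
    by_cases hc : W.Conforms X
    · exact ⟨W, hW, hW0, hs, hc⟩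
    · unfold SignVec.Conforms at hc
      push Not at hc
      obtain ⟨e, he0, hne⟩ := hc
      have hXe : X e ≠ 0 := hs.1 he0
      obtain ⟨g, hg, hgW⟩ := Set.exists_of_ssubset hs
      have hgW : W g = 0 := by simpa [SignVec.supp] using hgW
      have hWe : W e = -X e := (SignType.eq_or_eq_neg_of_ne_zero hXe he0).resolve_left hne
      obtain ⟨Z, hZ, h0, h1, h2, h3, h4⟩ := M.exists_elim hX hW hXe hWe
      have hsub : Z.supp ⊆ X.supp := by
        intro f hf
        rcases h1 f with h | h | h
        · exact absurd h hf
        · exact fun h' => hf (h.trans h')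
        · exact hs.1 (show W f ≠ 0 from h ▸ hf)
      refine ih _ ?_ Z hZ ?_ ⟨hsub, fun h => h hXe h0⟩ rfl
      · rw [← hk]
        refine Set.ncard_lt_ncard ⟨fun f hf => ?_, fun h => (h ⟨he0, hne⟩).1 h0⟩
        rcases h1 f with h | h | h
        · exact absurd h hf.1
        · exact absurd h hf.2
        · exact ⟨h ▸ hf.1, h ▸ hf.2⟩
      · intro h
        apply hg
        -- At `g`, in the support of `X` but not of `W`, the eliminated vector keeps the entry of
        -- `X`, so it is nonzero.
        rw [← h2 g hgW, h]; rfl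

/-- Every nonzero vector has a circuit that is conformal to it. -/
theorem exists_circuit_conforms [Finite E] {X : SignVec E} (hX : X ∈ M.vectors) (h0 : X ≠ 0) :
    ∃ C, M.IsCircuit C ∧ C.Conforms X := by
  obtain ⟨k, hk⟩ : ∃ k, X.supp.ncard = k := ⟨_, rfl⟩
  induction k using Nat.strong_induction_on generalizing X with
  | _ k ih =>
    by_cases hc : M.IsCircuit X
    · exact ⟨X, hc, fun e => Or.inr rfl⟩
    · have : ∃ W ∈ M.vectors, W ≠ 0 ∧ W.supp ⊂ X.supp := by
        by_contra h
        exact hc ⟨hX, h0, h⟩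
      obtain ⟨W, hW, hW0, hWs⟩ := this
      obtain ⟨Y, hY, hY0, hYs, hYc⟩ := exists_conforms_of_ssubset hX _ W hW hW0 hWs rfl
      obtain ⟨C, hC, hCY⟩ := ih _ (hk ▸ Set.ncard_lt_ncard hYs) hY hY0 rfl
      exact ⟨C, hC, hCY.trans hYc⟩

theorem exists_circuit_supp_subset [Finite E] {X : SignVec E} (hX : X ∈ M.vectors)
    (h0 : X ≠ 0) : ∃ C, M.IsCircuit C ∧ C.supp ⊆ X.supp := by
  obtain ⟨C, hC, hc⟩ := exists_circuit_conforms hX h0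
  refine ⟨C, hC, fun e he h => ?_⟩
  rcases hc e with h' | h'
  · exact he h'
  · exact he (h'.trans h)

theorem IsBasis.eq_zero [Finite E] {B : Set E} (hB : M.IsBasis B) {X : SignVec E}
    (hX : X ∈ M.vectors) (hs : ∀ e, X e ≠ 0 → e ∈ B) : X = 0 := by
  by_contra h0
  obtain ⟨C, hC, hCX⟩ := exists_circuit_supp_subset hX h0
  exact hB.1 C hC (hCX.trans hs)

theorem isBasis_of [Finite E] {B : Set E}
    (hI : ∀ X ∈ M.vectors, (∀ e, X e ≠ 0 → e ∈ B) → X = 0)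
    (hS : ∀ f ∉ B, ∃ X ∈ M.vectors, (∀ e, X e ≠ 0 → e = f ∨ e ∈ B) ∧ X ≠ 0) : M.IsBasis B := by
  refine ⟨fun C hC hs => hC.2.1 (hI C hC.1 hs), fun A hA hBA f hf => ?_⟩
  by_contra hfB
  obtain ⟨X, hX, hs, h0⟩ := hS f hfB
  obtain ⟨C, hC, hCX⟩ := exists_circuit_supp_subset hX h0
  refine hA C hC fun e he => ?_
  rcases hs e (hCX he) with rfl | h
  · exact hf
  · exact hBA h

theorem IsCircuit.neg {C : SignVec E} (hC : M.IsCircuit C) : M.IsCircuit (-C) := by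
  have hs : (-C).supp = C.supp := by ext; simp [SignVec.supp]
  refine ⟨M.neg_mem _ hC.1, fun h => hC.2.1 (funext fun e => ?_), hs ▸ hC.2.2⟩
  exact SignType.neg_eq_zero_iff.1 (congrFun h e)

theorem IsBasis.exists_fundamental {B : Set E} (hB : M.IsBasis B) {e : E} (he : e ∉ B) :
    ∃ C, M.IsFundamentalCircuit B e C := by
  have : ∃ C, M.IsCircuit C ∧ C.supp ⊆ insert e B := by
    by_contra! h
    exact he (hB.2 h (Set.subset_insert e B) (Set.mem_insert e B))
  obtain ⟨C, hC, hs⟩ := this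
  have hCe : C e ≠ 0 := fun h0 => hB.1 C hC fun f hf =>
    (hs hf).resolve_left fun h => hf (h ▸ h0)
  rcases SignType.trichotomy (C e) with h | h | h
  · refine ⟨-C, hC.neg, fun f hf => hs ?_, by rw [Pi.neg_apply, h, neg_neg]⟩
    simpa [SignVec.supp] using hf
  · exact absurd h hCe
  · exact ⟨C, hC, hs, h⟩

theorem isFundamentalCircuit_fundamentalCircuit {B : Set E} (hB : M.IsBasis B) {e : E}
    (he : e ∉ B) : M.IsFundamentalCircuit B e (M.fundamentalCircuit B e) := by
  unfold fundamentalCircuit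
  rw [dif_pos ⟨hB, he, hB.exists_fundamental he⟩]
  exact Exists.choose_spec _

/-- Basis exchange along a vector supported in `insert x B`. -/
theorem IsBasis.swap [Finite E] {B : Set E} (hB : M.IsBasis B) {e x : E} (he : e ∈ B)
    (hx : x ∉ B) {D : SignVec E} (hD : D ∈ M.vectors) (hs : ∀ f, D f ≠ 0 → f = x ∨ f ∈ B)
    (hDe : D e ≠ 0) : M.IsBasis (insert x (B \ {e})) := by
  have hex : e ≠ x := fun h => hx (h ▸ he)
  have hDx : D x ≠ 0 := fun h0 => hDe <| congrFun (hB.eq_zero hD fun f hf =>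
    (hs f hf).resolve_left fun h => hf (h ▸ h0)) e
  refine isBasis_of (fun W hW hWs => ?_) (fun f hf => ?_)
  · by_contra hW0
    have hWe : W e = 0 := by
      by_contra h
      rcases hWs e h with h | h
      · exact hex h
      · exact h.2 rfl
    have hWx : W x ≠ 0 := fun h0 => hW0 <| hB.eq_zero hW fun f hf =>
      ((hWs f hf).resolve_left fun h => hf (h ▸ h0)).1
    -- Removing `x` from `W` by means of `D` leaves a vector supported in `B`, yet nonzero at `e`.
    obtain ⟨Z, hZ, h0, h1, -, h3⟩ := exists_elim_supp hW hD hWx hDx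
    refine h3 e hWe hDe (congrFun (hB.eq_zero hZ fun f hf => ?_) e)
    have hfx : f ≠ x := fun h => hf (h ▸ h0)
    rcases h1 f hf with h | h
    · exact ((hWs f h).resolve_left hfx).1
    · exact (hs f h).resolve_left hfx
  · by_cases hfe : f = e
    · subst hfe
      refine ⟨D, hD, fun g hg => ?_, fun h => hDe (congrFun h f)⟩
      by_cases hgf : g = f
      · exact Or.inl hgf
      · rcases hs g hg with h | h
        · exact Or.inr (Or.inl h)
        · exact Or.inr (Or.inr ⟨h, hgf⟩)
    · have hfx : f ≠ x := fun h => hf (Or.inl h)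
      have hfB : f ∉ B := fun h => hf (Or.inr ⟨h, hfe⟩)
      obtain ⟨C, hC, hCs, hCf⟩ := hB.exists_fundamental hfB
      have hDf : D f = 0 := by
        by_contra h
        exact (hs f h).elim hfx hfB
      have hCf0 : C f ≠ 0 := by rw [hCf]; decide
      by_cases hCe : C e = 0
      · refine ⟨C, hC.1, fun g hg => ?_, hC.2.1⟩
        rcases hCs hg with h | h
        · exact Or.inl h
        · exact Or.inr (Or.inr ⟨h, fun h' => hg (h' ▸ hCe)⟩)
      -- `D` removes `e` from the fundamental circuit of `f`; the entry at `f` survives because `D`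
      -- vanishes there.
      · obtain ⟨Z, hZ, h0, h1, h2, -⟩ := exists_elim_supp hC.1 hD hCe hDe
        refine ⟨Z, hZ, fun g hg => ?_, fun h => hCf0 ?_⟩
        · have hge : g ≠ e := fun h => hg (h ▸ h0)
          rcases h1 g hg with h | h
          · rcases hCs h with h | h
            · exact Or.inl h
            · exact Or.inr (Or.inr ⟨h, hge⟩)
          · rcases hs g h with h | h
            · exact Or.inr (Or.inl h)
            · exact Or.inr (Or.inr ⟨h, hge⟩)
        · rw [← h2 f hDf, h]; rfl

@[ext]
theorem ext {M N : OrientedMatroid E} (h : M.vectors = N.vectors) : M = N := by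
  cases M; cases N; simp_all

/-! ### Relabelling -/

theorem isCircuit_relabel {σ : Equiv.Perm E} {C : SignVec E} :
    (M.relabel σ).IsCircuit C ↔ M.IsCircuit (fun e => C (σ e)) := by
  have hne : ∀ X : SignVec E, X ≠ 0 ↔ (fun e => X (σ e)) ≠ 0 := by
    intro X
    refine not_congr ⟨fun h => by subst h; rfl, fun h => funext fun e => ?_⟩
    simpa using congrFun h (σ.symm e)
  have hss : ∀ X Y : SignVec E,
      X.supp ⊂ Y.supp ↔ SignVec.supp (fun e => X (σ e)) ⊂ SignVec.supp (fun e => Y (σ e)) := by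
    have hsub : ∀ X Y : SignVec E,
        X.supp ⊆ Y.supp ↔ SignVec.supp (fun e => X (σ e)) ⊆ SignVec.supp (fun e => Y (σ e)) := by
      intro X Y
      refine ⟨fun h e he => h he, fun h e he => ?_⟩
      have := @h (σ.symm e) (by simpa [SignVec.supp] using he)
      simpa [SignVec.supp] using this
    intro X Y
    rw [ssubset_iff_subset_not_subset, ssubset_iff_subset_not_subset, hsub X Y, hsub Y X]
  refine and_congr Iff.rfl (and_congr (hne C) (not_congr ⟨?_, ?_⟩))
  · rintro ⟨X, hX, h0, hs⟩
    exact ⟨_, hX, (hne X).1 h0, (hss _ _).1 hs⟩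
  · rintro ⟨X, hX, h0, hs⟩
    refine ⟨fun e => X (σ.symm e), by simpa [relabel] using hX, ?_, ?_⟩
    · rw [hne]; simpa using h0
    · rw [hss]; simpa using hs

theorem IsBasis.relabel [Finite E] {σ : Equiv.Perm E} {B : Set E} (hB : M.IsBasis (σ ⁻¹' B)) :
    (M.relabel σ).IsBasis B := by
  refine isBasis_of (fun X hX hs => ?_) (fun f hf => ?_)
  · have := hB.eq_zero hX fun e he => hs _ he
    funext e
    simpa using congrFun this (σ.symm e)
  · obtain ⟨C, hC, hs, hCf⟩ := hB.exists_fundamental (e := σ.symm f) (by simpa using hf)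
    refine ⟨fun e => C (σ.symm e), by simpa [OrientedMatroid.relabel] using hC.1,
      fun e he => ?_, fun h => ?_⟩
    · rcases hs he with h | h
      · exact Or.inl (σ.symm.injective h)
      · exact Or.inr (by simpa using h)
    · have := congrFun h f
      simp [hCf] at this

end OrientedMatroid

/-! ### Transversals of the complementary pairs -/

namespace ComplementedSet

variable {E : Type*} {n : ℕ} (G : ComplementedSet E n)

/-- A set that contains exactly one element of each complementary pair. -/
def IsTransversal (B : Set E) : Prop := ∀ e, G.compl e ∈ B ↔ e ∉ B

theorem compl_injective : Function.Injective G.compl :=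
  Function.LeftInverse.injective G.compl_compl

variable {G} in
theorem IsTransversal.compl_ne {B : Set E} (hB : G.IsTransversal B) (e : E) :
    G.compl e ≠ e := by
  intro h
  have := hB e
  rw [h] at this
  tauto

/-- The set and its complement image are disjoint with `n` elements each, so together they exhaust
the `2n` elements. -/
theorem isTransversal_of_ncard [Finite E] {B : Set E} (h : G.IsComplementary B)
    (hn : B.ncard = n) : G.IsTransversal B := by
  have hc : (G.compl '' B).ncard = n := by
    rw [Set.ncard_image_of_injective _ G.compl_injective, hn]
  have hu : B ∪ G.compl '' B = Set.univ := by
    apply Set.eq_of_subset_of_ncard_le (Set.subset_univ _)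
    rw [← G.union_eq, Set.ncard_union_eq h, Set.ncard_union_eq G.disj, G.card_S, G.card_T, hn, hc]
  intro e
  constructor
  · intro h1 h2
    exact Set.disjoint_left.1 h h1 ⟨e, h2, rfl⟩
  · intro h1
    have : e ∈ B ∪ G.compl '' B := hu ▸ Set.mem_univ e
    rcases this with h2 | ⟨f, hf, rfl⟩
    · exact absurd h2 h1
    · rwa [G.compl_compl]

theorem isComplementary_S : G.IsComplementary G.S := by
  rw [IsComplementary, Set.disjoint_left]
  rintro _ h ⟨f, hf, rfl⟩
  exact Set.disjoint_left.1 G.disj h (G.compl_mem f hf)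

theorem isTransversal_S [Finite E] : G.IsTransversal G.S :=
  G.isTransversal_of_ncard G.isComplementary_S G.card_S

variable {G} in
theorem IsTransversal.isComplementary {B : Set E} (hB : G.IsTransversal B) :
    G.IsComplementary B := by
  rw [IsComplementary, Set.disjoint_left]
  rintro _ h ⟨f, hf, rfl⟩
  exact (hB f).1 h hf

variable {G} in
theorem IsTransversal.eq_of_subset {B B' : Set E} (hB : G.IsTransversal B)
    (hB' : G.IsTransversal B') (h : B ⊆ B') : B = B' := by
  refine h.antisymm fun e he => ?_
  by_contra hn
  exact (hB' e).1 (h ((hB e).2 hn)) he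

variable {G} in
theorem IsTransversal.swap {B : Set E} (hB : G.IsTransversal B) {e : E} (he : e ∈ B) :
    G.IsTransversal (insert (G.compl e) (B \ {e})) := by
  intro f
  have hne := hB.compl_ne e
  have h1 := hB f
  have h2 := hB e
  simp only [Set.mem_insert_iff, Set.mem_sdiff, Set.mem_singleton_iff, G.compl_injective.eq_iff]
  by_cases hfe : f = e
  · subst hfe; simp [hne.symm]
  · by_cases hfe' : f = G.compl e
    · subst hfe'; simp [G.compl_compl, hfe]
    · have : G.compl f ≠ e := fun h => hfe' (by rw [← h, G.compl_compl])
      simp [hfe, hfe', this, h1]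

/-- This form does not mention `S`, so it is visibly invariant under exchanges. -/
theorem signReversing_iff [Finite E] {X : SignVec E} :
    G.SignReversing X ↔ ∀ e, X e * X (G.compl e) ≤ 0 := by
  refine ⟨fun h e => ?_, fun h e _ => h e⟩
  by_cases he : e ∈ G.S
  · exact h e he
  · have := h _ ((G.isTransversal_S e).2 he)
    rwa [G.compl_compl, mul_comm] at this

/-! ### P-matroids and the Z-property -/

variable {G}

/-- In a P-matroid no nonzero vector is sign-reversing. -/
theorem IsPMatroid.eq_zero [Finite E] {M : OrientedMatroid E} (hP : G.IsPMatroid M)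
    {X : SignVec E} (hX : X ∈ M.vectors) (h : ∀ e, X e * X (G.compl e) ≤ 0) : X = 0 := by
  by_contra h0
  obtain ⟨C, hC, hc⟩ := OrientedMatroid.exists_circuit_conforms hX h0
  refine hP.2 ⟨C, hC, fun e _ => ?_⟩
  rcases hc e with h1 | h1 <;> rcases hc (G.compl e) with h2 | h2 <;> simp only [h1, h2]
  · simp
  · simp
  · simp
  · exact h e

/-- A vector of a P-matroid that meets no complementary pair except possibly that of `e`, and
does not vanish, has equal nonzero entries at `e` and its complement. -/
theorem IsPMatroid.mul_compl_pos [Finite E] {M : OrientedMatroid E} (hP : G.IsPMatroid M)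
    {B : Set E} (hB : G.IsTransversal B) {e : E} (he : e ∈ B) {X : SignVec E}
    (hX : X ∈ M.vectors) (h0 : X ≠ 0) (hs : ∀ f, X f ≠ 0 → f = G.compl e ∨ f ∈ B) :
    0 < X e * X (G.compl e) := by
  by_contra hn
  refine h0 (hP.eq_zero hX fun f => ?_)
  by_cases hfe : f = e
  · subst hfe; exact not_lt.1 hn
  by_cases hfe' : f = G.compl e
  · subst hfe'; rw [G.compl_compl, mul_comm]; exact not_lt.1 hn
  by_contra hpos
  have h1 : X f ≠ 0 := fun h => by simp [h] at hpos
  have h2 : X (G.compl f) ≠ 0 := fun h => by simp [h] at hpos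
  have h3 := (hs _ h1).resolve_left hfe'
  have h4 := (hs _ h2).resolve_left fun h => hfe (G.compl_injective h)
  exact (hB f).1 h4 h3

/-- Walk from `S` to `B` one pair at a time: the P-property makes the fundamental circuit of the
entering element nonzero at its complement, so the exchange is a basis exchange. -/
theorem IsPMatroid.isBasis_of_isTransversal [Finite E] {M : OrientedMatroid E}
    (hP : G.IsPMatroid M) {B : Set E} (hB : G.IsTransversal B) : M.IsBasis B := by
  suffices H : ∀ k, ∀ A, G.IsTransversal A → M.IsBasis A → (B \ A).ncard = k → M.IsBasis B from
    H _ G.S G.isTransversal_S hP.1 rfl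
  intro k
  induction k using Nat.strong_induction_on with
  | _ k ih =>
    intro A hA hAb hk
    by_cases hBA : B ⊆ A
    · rwa [hB.eq_of_subset hA hBA]
    obtain ⟨x, hxB, hxA⟩ := Set.not_subset.1 hBA
    have he : G.compl x ∈ A := (hA x).2 hxA
    obtain ⟨D, hD, hs, hDx⟩ := hAb.exists_fundamental hxA
    have hpos := hP.mul_compl_pos hA he hD.1 hD.2.1 (fun f hf => by
      rw [G.compl_compl]; exact hs hf)
    have hbasis := hAb.swap he hxA hD.1 (fun f hf => hs hf) (fun h => by simp [h] at hpos)
    have htr := hA.swap he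
    rw [G.compl_compl] at htr
    refine ih _ ?_ _ htr hbasis rfl
    rw [← hk]
    refine Set.ncard_lt_ncard ⟨?_, fun h => (h ⟨hxB, hxA⟩).2 (Or.inl rfl)⟩
    rintro f ⟨hfB, hf⟩
    refine ⟨hfB, fun hfA => hf (Or.inr ⟨hfA, ?_⟩)⟩
    rintro rfl
    exact (hB x).1 hfB hxB

/-- In a P-matroid with the Z-property, a vector whose negative entries on the complement of `S'`
have nonnegative partners is nonnegative on the complement of `S'`. -/
theorem IsPMatroid.nonneg_of_zProperty [Finite E] {M : OrientedMatroid E} (hP : G.IsPMatroid M)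
    {S' : Set E} (hS' : G.IsTransversal S') (hZ : G.ZProperty M S') {D : SignVec E}
    (hD : D ∈ M.vectors) (h : ∀ f ∉ S', D f = -1 → 0 ≤ D (G.compl f)) : ∀ f ∉ S', 0 ≤ D f := by
  obtain ⟨k, hk⟩ : ∃ k, {f | f ∉ S' ∧ D f = 1}.ncard = k := ⟨_, rfl⟩
  induction k using Nat.strong_induction_on generalizing D with
  | _ k ih =>
    by_cases hex : ∃ t ∉ S', D t = 1
    · obtain ⟨t, ht, hDt⟩ := hex
      obtain ⟨C, hC, hCs, hCt⟩ := (hP.isBasis_of_isTransversal hS').exists_fundamental ht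
      have hC0 : ∀ f ∉ S', f ≠ t → C f = 0 := by
        intro f hf hft
        by_contra h0
        exact (hCs h0).elim hft hf
      -- On `T'` the circuit `C` is supported at `t` alone, so a positive entry at any other `s` in
      -- `S'` would violate the Z-property.
      have hCneg : ∀ s ∈ S', G.compl s ≠ t → C s ≤ 0 := by
        intro s hs hst
        by_contra hpos
        have hs1 : C s = 1 := by revert hpos; generalize C s = a; revert a; decide
        have := hZ C hC (by
          rintro _ ⟨f, hf, rfl⟩
          by_cases hft : G.compl f = t
          · rw [hft, hCt]; decide
          · rw [hC0 _ (fun h => (hS' f).1 h hf) hft]) s hs hs1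
        rw [hC0 _ (fun h => (hS' s).1 h hs) hst] at this
        exact absurd this (by decide)
      -- Subtracting `C` deletes the positive entry at `t`, leaves the rest of `T'` unchanged, and
      -- cannot make a nonnegative partner of another element negative.
      obtain ⟨W, hW, h0, h1, h2, -, -⟩ := M.exists_elim hD (M.neg_mem C hC.1) (e := t)
        (by rw [hDt]; decide) (by rw [Pi.neg_apply, hCt, hDt])
      have hWD : ∀ f ∉ S', f ≠ t → W f = D f := fun f hf hft =>
        h2 f (by rw [Pi.neg_apply, hC0 f hf hft, neg_zero])
      have hWt : ∀ f ∉ S', W f ≠ 0 → f ≠ t := fun f hf hf0 hft => hf0 (hft ▸ h0)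
      have hlt : {f | f ∉ S' ∧ W f = 1}.ncard < k := by
        rw [← hk]
        refine Set.ncard_lt_ncard ⟨?_, fun hh => ?_⟩
        · rintro f ⟨hf, hf1⟩
          refine ⟨hf, ?_⟩
          rw [← hWD f hf (hWt f hf (by rw [hf1]; decide)), hf1]
        · have : W t = 1 := (hh ⟨ht, hDt⟩).2
          rw [h0] at this
          exact absurd this (by decide)
      have hW' : ∀ f ∉ S', 0 ≤ W f := by
        refine ih _ hlt hW (fun f hf hf1 => ?_) rfl
        have hft := hWt f hf (by rw [hf1]; decide)
        have hDf := h f hf (by rw [← hWD f hf hft, hf1])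
        have hCf := hCneg (G.compl f) ((hS' f).2 hf) (by rwa [G.compl_compl])
        rcases h1 (G.compl f) with h3 | h3 | h3 <;> rw [h3]
        · exact hDf
        · rw [Pi.neg_apply]
          revert hCf; generalize C (G.compl f) = a; revert a; decide
      intro f hf
      by_cases hft : f = t
      · rw [hft, hDt]; decide
      · rw [← hWD f hf hft]; exact hW' f hf
    -- With no positive entry on `T'`, the hypothesis makes `D` sign-reversing, hence zero.
    · push Not at hex
      have hnp : ∀ f ∉ S', D f * D (G.compl f) ≤ 0 := by
        intro f hf
        have h1 := hex f hf
        have h2 := h f hf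
        revert h1 h2
        generalize D f = a
        generalize D (G.compl f) = b
        revert a b; decide
      have hD0 : D = 0 := by
        refine hP.eq_zero hD fun f => ?_
        by_cases hf : f ∈ S'
        · have := hnp _ (fun h => (hS' f).1 h hf)
          rwa [G.compl_compl, mul_comm] at this
        · exact hnp f hf
      intro f _
      rw [hD0]; rfl

/-! ### Principal pivot transforms -/

theorem exchange_exchange (F : Set E) (e : E) : G.exchange F (G.exchange F e) = e :=
  Function.Involutive.toPerm_involutive _ e

open Classical in
theorem exchange_apply (F : Set E) (e : E) :
    G.exchange F e = if e ∈ F ∨ G.compl e ∈ F then G.compl e else e := rfl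

theorem exchange_compl (F : Set E) (e : E) :
    G.exchange F (G.compl e) = G.compl (G.exchange F e) := by
  classical
  rw [exchange_apply, exchange_apply, G.compl_compl]
  by_cases h : e ∈ F ∨ G.compl e ∈ F
  · rw [if_pos h, if_pos h.symm, G.compl_compl]
  · rw [if_neg h, if_neg (fun h' => h h'.symm)]

theorem principalPivot_principalPivot (F : Set E) (M : OrientedMatroid E) :
    G.principalPivot F (G.principalPivot F M) = M := by
  ext X
  simp [principalPivot, OrientedMatroid.relabel, exchange_exchange]

/-- The preimage of `S` under the exchange is a transversal, hence already a basis of `M`. -/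
theorem IsPMatroid.principalPivot [Finite E] {M : OrientedMatroid E} (hP : G.IsPMatroid M)
    (F : Set E) : G.IsPMatroid (G.principalPivot F M) := by
  refine ⟨OrientedMatroid.IsBasis.relabel (hP.isBasis_of_isTransversal fun e => ?_), ?_⟩
  · rw [Set.mem_preimage, Set.mem_preimage, exchange_compl]
    exact G.isTransversal_S _
  · rintro ⟨C, hC, hr⟩
    rw [signReversing_iff] at hr
    refine hP.2 ⟨_, OrientedMatroid.isCircuit_relabel.1 hC, fun e _ => ?_⟩
    simpa only [exchange_compl] using hr (G.exchange F e)

theorem ZProperty.principalPivot {M : OrientedMatroid E} {S' : Set E}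
    (hZ : G.ZProperty M S') (F : Set E) :
    G.ZProperty (G.principalPivot F M) (G.exchange F '' S') := by
  rintro C hC hpos _ ⟨e, he, rfl⟩ hCe
  have := hZ _ (OrientedMatroid.isCircuit_relabel.1 hC) (by
    rintro _ ⟨f, hf, rfl⟩
    simp only [exchange_compl]
    exact hpos _ ⟨_, ⟨f, hf, rfl⟩, rfl⟩) e he hCe
  simpa only [exchange_compl] using this

theorem IsTransversal.exchange {S' : Set E} (hS' : G.IsTransversal S') (F : Set E) :
    G.IsTransversal (G.exchange F '' S') := by
  have hmem : ∀ e, e ∈ G.exchange F '' S' ↔ G.exchange F e ∈ S' := by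
    intro e
    constructor
    · rintro ⟨f, hf, rfl⟩
      rwa [exchange_exchange]
    · exact fun h => ⟨_, h, exchange_exchange F e⟩
  intro e
  rw [hmem, hmem, exchange_compl]
  exact hS' _

theorem IsKStarMatroid.principalPivot [Finite E] {M : OrientedMatroid E}
    (h : G.IsKStarMatroid M) (F : Set E) : G.IsKStarMatroid (G.principalPivot F M) := by
  obtain ⟨hP, -, S', hc, hn, hZ⟩ := h
  have hP' := hP.principalPivot F
  refine ⟨hP', hP'.1, _, ((G.isTransversal_of_ncard hc hn).exchange F).isComplementary, ?_,
    hZ.principalPivot F⟩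
  rw [Set.ncard_image_of_injective _ (G.exchange F).injective, hn]

theorem IsKMatroid.isKStarMatroid {M : OrientedMatroid E} (h : G.IsKMatroid M) :
    G.IsKStarMatroid M :=
  ⟨h.1, h.1.1, G.S, G.isComplementary_S, G.card_S, h.2.2⟩

theorem isKStarMatroid_iff_principalPivotClosure [Finite E] (M : OrientedMatroid E) :
    G.IsKStarMatroid M ↔ G.PrincipalPivotClosure G.IsKMatroid M := by
  constructor
  · rintro ⟨hP, -, S', hc, hn, hZ⟩
    have hS' := G.isTransversal_of_ncard hc hn
    have hF : G.IsComplementary (S' \ G.S) := by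
      rw [IsComplementary, Set.disjoint_left]
      rintro _ h ⟨f, hf, rfl⟩
      exact (hS' f).1 h.1 hf.1
    have himg : G.exchange (S' \ G.S) '' S' = G.S := by
      classical
      refine (hS'.exchange _).eq_of_subset G.isTransversal_S ?_
      rintro _ ⟨e, he, rfl⟩
      rw [exchange_apply]
      by_cases heS : e ∈ G.S
      · rwa [if_neg]
        rintro (h | h)
        · exact h.2 heS
        · exact (hS' e).1 h.1 he
      · rw [if_pos (Or.inl ⟨he, heS⟩)]
        exact (G.isTransversal_S e).2 heS
    -- Present `M` as the transform of its own transform, which is a K-matroid.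
    rw [← principalPivot_principalPivot (G := G) (S' \ G.S) M]
    have hP' := hP.principalPivot (S' \ G.S)
    refine .pivot _ _ hF (.base _ ⟨hP', hP'.1, ?_⟩)
    have := hZ.principalPivot (S' \ G.S)
    rwa [himg] at this
  · intro h
    induction h with
    | base M hM => exact hM.isKStarMatroid
    | pivot M F _ _ ih => exact ih.principalPivot F

/-! ### Simple principal pivoting -/

section Extension

variable {M : OrientedMatroid E} {Mhat : OrientedMatroid (Option E)}

theorem restrict_mem (hM : Mhat.IsOnePointExtension M) {X : SignVec (Option E)}
    (hX : X ∈ Mhat.vectors) (h0 : X none = 0) : (fun e => X (some e)) ∈ M.vectors := by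
  rw [hM.1]
  exact ⟨X, hX, h0, rfl⟩

theorem none_notMem (B : Set E) : (none : Option E) ∉ some '' B := by simp

/-- A complementary set that is a basis of a one-point extension of a P-matroid contains an element
of each complementary pair. -/
theorem IsPMatroid.isTransversal_of_isBasis_extension [Finite E] (hP : G.IsPMatroid M)
    (hM : Mhat.IsOnePointExtension M) {B : Set E} (hc : G.IsComplementary B)
    (hB : Mhat.IsBasis (some '' B)) : G.IsTransversal B := by
  have hdis : ∀ e, G.compl e ∈ B → e ∉ B := fun e h1 h2 =>
    Set.disjoint_left.1 hc h1 ⟨e, h2, rfl⟩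
  refine fun e => ⟨hdis e, fun he => ?_⟩
  by_contra he'
  obtain ⟨C, hC, hs, hCe⟩ := hB.exists_fundamental (e := some e) (by simpa using he)
  have hs' : ∀ f, C (some f) ≠ 0 → f = e ∨ f ∈ B := fun f hf => by
    simpa using hs hf
  have hnone : C none = 0 := by
    by_contra h
    simpa using hs h
  -- If a pair is missed altogether, `C` meets no pair in both elements, so the P-property forces it
  -- to vanish.
  have := hP.eq_zero (restrict_mem hM hC.1 hnone) fun f => by
    by_contra hpos
    have h1 : C (some f) ≠ 0 := fun h => by simp [h] at hpos
    have h2 : C (some (G.compl f)) ≠ 0 := fun h => by simp [h] at hpos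
    rcases hs' _ h1 with h1 | h1 <;> rcases hs' _ h2 with h2 | h2
    · subst h1
      have ht := G.isTransversal_S.compl_ne f
      exact ht h2
    · exact he' (h1 ▸ h2)
    · rw [← h2, G.compl_compl] at he'
      exact he' h1
    · exact hdis f h2 h1
  have h1 := congrFun this e
  simp [hCe] at h1

/-- The fundamental circuit of the entering element vanishes at `q`, so the P-property of `M`
applies to it and makes it nonzero at `e`. -/
theorem IsPMatroid.swap_extension [Finite E] (hP : G.IsPMatroid M)
    (hM : Mhat.IsOnePointExtension M) {B : Set E} (ht : G.IsTransversal B)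
    (hB : Mhat.IsBasis (some '' B)) {e : E} (he : e ∈ B) :
    Mhat.IsBasis (some '' insert (G.compl e) (B \ {e})) := by
  have hx : G.compl e ∉ B := fun h => (ht e).1 h he
  have hx' : some (G.compl e) ∉ some '' B := by simpa using hx
  obtain ⟨D, hD, hs, hDx⟩ := hB.exists_fundamental hx'
  have hnone : D none = 0 := by
    by_contra h
    simpa using hs h
  have hpos := hP.mul_compl_pos ht he (restrict_mem hM hD.1 hnone)
    (fun h => by simpa [hDx] using congrFun h (G.compl e)) (fun f hf => by simpa using hs hf)
  have := hB.swap (Set.mem_image_of_mem some he) hx' hD.1 (fun f hf => hs hf)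
    (fun h => by simp [h] at hpos)
  convert this using 1
  rw [Set.image_insert_eq, Set.image_sdiff (Option.some_injective E), Set.image_singleton]

/-- The effect of a pivot step at a negative entry `e` on the fundamental circuits of `q`. -/
theorem IsPMatroid.pivot_sign [Finite E] (hP : G.IsPMatroid M)
    (hM : Mhat.IsOnePointExtension M) {S' : Set E} (hS' : G.IsTransversal S')
    (hZ : G.ZProperty M S') {B : Set E} (ht : G.IsTransversal B) {e : E}
    {X Y : SignVec (Option E)} (hX : Mhat.IsFundamentalCircuit (some '' B) none X)
    (hY : Mhat.IsFundamentalCircuit (some '' insert (G.compl e) (B \ {e})) none Y)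
    (hXe : X (some e) = -1) :
    Y (some (G.compl e)) = 1 ∧ ∀ f ∉ S', X (some f) = 1 → Y (some f) = 1 := by
  have hXs : ∀ f, X (some f) ≠ 0 → f ∈ B := fun f hf => by simpa using hX.2.1 hf
  have hYs : ∀ f, Y (some f) ≠ 0 → f = G.compl e ∨ f ∈ B ∧ f ≠ e := fun f hf => by
    simpa using hY.2.1 hf
  have he : e ∈ B := hXs e (by rw [hXe]; decide)
  have hne : G.compl e ≠ e := ht.compl_ne e
  have hxB : G.compl e ∉ B := fun h => (ht e).1 h he
  have hYe : Y (some e) = 0 := by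
    by_contra h
    rcases hYs e h with h | h
    · exact hne h.symm
    · exact h.2 rfl
  have hXx : X (some (G.compl e)) = 0 := by
    by_contra h
    exact hxB (hXs _ h)
  obtain ⟨Z, hZv, h0, h1, h2, h3, h4⟩ := Mhat.exists_elim hY.1.1 (Mhat.neg_mem X hX.1.1)
    (e := none) (by rw [hY.2.2]; decide) (by rw [Pi.neg_apply, hX.2.2, hY.2.2])
  have hZe : Z (some e) = 1 := by
    rw [h3 _ hYe, Pi.neg_apply, hXe]; rfl
  have hZx : Z (some (G.compl e)) = Y (some (G.compl e)) := h2 _ (by simp [hXx])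
  have hZs : ∀ f, Z (some f) ≠ 0 → f = G.compl e ∨ f ∈ B := by
    intro f hf
    rcases h1 (some f) with h | h | h
    · exact absurd h hf
    · exact (hYs f (h ▸ hf)).imp_right And.left
    · refine Or.inr (hXs f fun h' => hf ?_)
      rw [h, Pi.neg_apply, h', neg_zero]
  have hZm := restrict_mem hM hZv h0
  have hpos := hP.mul_compl_pos ht he hZm
    (fun h => by simpa [hZe] using congrFun h e) hZs
  have hYx : Y (some (G.compl e)) = 1 := by
    rw [hZe, one_mul, hZx] at hpos
    revert hpos; generalize Y (some (G.compl e)) = a; revert a; decide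
  refine ⟨hYx, fun f hf hXf => ?_⟩
  -- A negative element of `Z` lies outside the pair of `e`, and there `Z` vanishes at the partner.
  have hnn := hP.nonneg_of_zProperty hS' hZ hZm (fun g _ hg => ?_) f hf
  · have h5 := h2 (some f)
    have h6 := h3 (some f)
    have h7 := h4 (some f)
    have h8 := h1 (some f)
    simp only [Pi.neg_apply, hXf] at h5 h6 h7 h8
    revert hnn h5 h6 h7 h8
    generalize Y (some f) = a
    generalize Z (some f) = b
    revert a b; decide
  · have hge : g ≠ e := fun h => by
      rw [h, hZe] at hg; exact absurd hg (by decide)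
    have hgx : g ≠ G.compl e := fun h => by
      rw [h, hZx, hYx] at hg; exact absurd hg (by decide)
    have hgB : g ∈ B := (hZs g (by rw [hg]; decide)).resolve_left hgx
    by_contra hlt
    rcases hZs (G.compl g) (fun h => hlt (by rw [h])) with h | h
    · exact hge (G.compl_injective h)
    · exact (ht g).1 h hgB

/-- Eliminating `q` between `X` and `-Y` gives a sign-reversing vector: equal nonzero signs on a
pair would contradict complementarity of `X` (both positive) or of `Y` (both negative). Its
vanishing forces equal supports. -/
theorem IsSolution.eq [Finite E] (hP : G.IsPMatroid M) (hM : Mhat.IsOnePointExtension M)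
    {X Y : SignVec (Option E)} (hX : G.IsSolution Mhat X) (hY : G.IsSolution Mhat Y) : X = Y := by
  obtain ⟨hXv, hX0, hX1, hXc⟩ := hX
  obtain ⟨hYv, hY0, hY1, hYc⟩ := hY
  obtain ⟨Z, hZ, h0, h1, h2, h3, -⟩ := Mhat.exists_elim hXv (Mhat.neg_mem Y hYv)
    (e := none) (by rw [hX1]; decide) (by rw [Pi.neg_apply, hX1, hY1])
  have hz := hP.eq_zero (restrict_mem hM hZ h0) fun e => by
    have a1 := h1 (some e)
    have a2 := h1 (some (G.compl e))
    have a3 := hX0 (some e)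
    have a4 := hX0 (some (G.compl e))
    have a5 := hY0 (some e)
    have a6 := hY0 (some (G.compl e))
    have a7 := hXc e
    have a8 := hYc e
    rw [Pi.neg_apply] at a1 a2
    have key : ∀ x y : SignType, 0 ≤ x → 0 ≤ y → ∀ z : SignType, (z = 0 ∨ z = x ∨ z = -y) →
        (z = 1 → x = 1) ∧ (z = -1 → y = 1) := by decide
    obtain ⟨b1, b2⟩ := key _ _ a3 a5 _ a1
    obtain ⟨b3, b4⟩ := key _ _ a4 a6 _ a2
    by_contra hpos
    have : (Z (some e) = 1 ∧ Z (some (G.compl e)) = 1) ∨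
        (Z (some e) = -1 ∧ Z (some (G.compl e)) = -1) := by
      revert hpos
      generalize Z (some e) = a
      generalize Z (some (G.compl e)) = b
      revert a b; decide
    rcases this with ⟨c1, c2⟩ | ⟨c1, c2⟩
    · rw [b1 c1, b3 c2] at a7; exact absurd a7 (by decide)
    · rw [b2 c1, b4 c2] at a8; exact absurd a8 (by decide)
  funext e
  cases e with
  | none => rw [hX1, hY1]
  | some e =>
    have a0 : Z (some e) = 0 := congrFun hz e
    have a1 := h2 (some e)
    have a2 := h3 (some e)
    have a3 := hX0 (some e)
    have a4 := hY0 (some e)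
    rw [Pi.neg_apply, a0] at a1 a2
    revert a1 a2 a3 a4
    generalize X (some e) = x
    generalize Y (some e) = y
    revert x y; decide

theorem isSolution_of_isFundamentalCircuit {B : Set E} (ht : G.IsTransversal B)
    {X : SignVec (Option E)} (hX : Mhat.IsFundamentalCircuit (some '' B) none X)
    (h : ∀ e, X e ≠ -1) : G.IsSolution Mhat X := by
  refine ⟨hX.1.1, fun e => ?_, hX.2.2, fun e => ?_⟩
  · have := h e
    revert this; generalize X e = a; revert a; decide
  · by_contra hne
    have hs : ∀ f, X (some f) ≠ 0 → f ∈ B := fun f hf => by simpa using hX.2.1 hf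
    exact (ht e).1 (hs _ (right_ne_zero_of_mul hne)) (hs _ (left_ne_zero_of_mul hne))

open Classical in
/-- A bound for the number of pivot steps that can still change the pair of an element `f` of the
complement of `S'`. -/
noncomputable def pairPotential (s : PivotState E) (f : E) : ℕ :=
  if f ∈ s.basis then if s.circuit (some f) = 1 then 0 else 2 else 1

/-- Every run of the algorithm from a state with a complementary basis is bounded by the sum of the
potentials of the pairs. -/
theorem IsPMatroid.exists_returns [Finite E] (hP : G.IsPMatroid M)
    (hM : Mhat.IsOnePointExtension M) {S' : Set E} (hS' : G.IsTransversal S')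
    (hZ : G.ZProperty M S') (R : PivotRule E) (T' : Finset E) (hT' : ∀ f, f ∈ T' ↔ f ∉ S')
    (m : ℕ) : ∀ s : PivotState E, G.IsTransversal s.basis → Mhat.IsBasis (some '' s.basis) →
      s.circuit = Mhat.fundamentalCircuit (some '' s.basis) none →
      ∑ f ∈ T', pairPotential s f ≤ m →
      ∃ k ≤ m, ∃ C, G.Returns Mhat R s k C ∧ G.IsSolution Mhat C := by
  induction m with
  | zero =>
    intro s ht hB hs hm
    have hX := OrientedMatroid.isFundamentalCircuit_fundamentalCircuit hB (none_notMem s.basis)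
    rw [← hs] at hX
    -- Zero total potential means that the basis is `T'` and the circuit is positive on it, so the
    -- algorithm halts.
    have hpot : ∀ f ∉ S', pairPotential s f = 0 := fun f hf =>
      Finset.sum_eq_zero_iff.1 (Nat.le_zero.1 hm) f ((hT' f).2 hf)
    have hbas : ∀ f ∉ S', f ∈ s.basis ∧ s.circuit (some f) = 1 := by
      intro f hf
      have := hpot f hf
      unfold pairPotential at this
      split_ifs at this with h1 h2
      exact ⟨h1, h2⟩
    have hneg : ∀ e, s.circuit e ≠ -1 := by
      intro e he
      cases e with
      | none => rw [hX.2.2] at he; exact absurd he (by decide)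
      | some e =>
        by_cases heS : e ∈ S'
        · have h1 : e ∈ s.basis := by
            simpa using hX.2.1 (show s.circuit (some e) ≠ 0 by rw [he]; decide)
          exact (ht e).1 (hbas _ (fun h => (hS' e).1 h heS)).1 h1
        · rw [(hbas e heS).2] at he; exact absurd he (by decide)
    exact ⟨0, le_rfl, _, .halt s hneg, isSolution_of_isFundamentalCircuit ht hX hneg⟩
  | succ m ih =>
    intro s ht hB hs hm
    have hX := OrientedMatroid.isFundamentalCircuit_fundamentalCircuit hB (none_notMem s.basis)
    rw [← hs] at hX
    by_cases hex : ∃ e : E, s.circuit (some e) = -1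
    · obtain ⟨e, he⟩ : ∃ e : E, e = R s hex := ⟨_, rfl⟩
      have hXe : s.circuit (some e) = -1 := he ▸ (R s hex).2
      have heB : e ∈ s.basis := by
        simpa using hX.2.1 (show s.circuit (some e) ≠ 0 by rw [hXe]; decide)
      have hB' := hP.swap_extension hM ht hB heB
      have hY := OrientedMatroid.isFundamentalCircuit_fundamentalCircuit hB' (none_notMem _)
      obtain ⟨hYx, hmono⟩ := hP.pivot_sign hM hS' hZ ht hX hY hXe
      have hxB : G.compl e ∉ s.basis := fun h => (ht e).1 h heB
      have hmem : ∀ f, f ∈ (G.pivotStep Mhat s e).basis ↔ f = G.compl e ∨ f ∈ s.basis ∧ f ≠ e :=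
        fun f => Iff.rfl
      have hYx' : (G.pivotStep Mhat s e).circuit (some (G.compl e)) = 1 := hYx
      have hmono' : ∀ f ∉ S', s.circuit (some f) = 1 →
          (G.pivotStep Mhat s e).circuit (some f) = 1 := hmono
      have hle : ∀ f ∈ T', pairPotential (G.pivotStep Mhat s e) f ≤ pairPotential s f := by
        intro f hf
        have hf' := (hT' f).1 hf
        unfold pairPotential
        by_cases hfx : f = G.compl e
        · rw [if_pos ((hmem f).2 (Or.inl hfx)), if_pos (hfx ▸ hYx')]
          exact Nat.zero_le _
        · by_cases hfe : f = e
          · subst hfe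
            rw [if_neg (fun h => ((hmem f).1 h).elim hfx fun h => h.2 rfl), if_pos heB,
              if_neg (by rw [hXe]; decide)]
            decide
          · by_cases hfB : f ∈ s.basis
            · rw [if_pos ((hmem f).2 (Or.inr ⟨hfB, hfe⟩)), if_pos hfB]
              by_cases h1 : s.circuit (some f) = 1
              · rw [if_pos h1, if_pos (hmono' f hf' h1)]
              · rw [if_neg h1]; split_ifs <;> decide
            · rw [if_neg (fun h => ((hmem f).1 h).elim hfx fun h => hfB h.1), if_neg hfB]
      -- The pair of `e` drops from 1 to 0 if its element of `T'` enters, and from 2 to 1 if it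
      -- leaves.
      have hlt : ∃ f ∈ T', pairPotential (G.pivotStep Mhat s e) f < pairPotential s f := by
        by_cases heS : e ∈ S'
        · refine ⟨G.compl e, (hT' _).2 fun h => (hS' e).1 h heS, ?_⟩
          unfold pairPotential
          rw [if_pos ((hmem _).2 (Or.inl rfl)), if_pos hYx', if_neg hxB]
          decide
        · refine ⟨e, (hT' e).2 heS, ?_⟩
          unfold pairPotential
          rw [if_neg (fun h => ((hmem e).1 h).elim (ht.compl_ne e).symm fun h => h.2 rfl),
            if_pos heB, if_neg (by rw [hXe]; decide)]
          decide
      have hsum := Finset.sum_lt_sum hle hlt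
      obtain ⟨k, hk, C, hC, hsol⟩ := ih (G.pivotStep Mhat s e) (ht.swap heB) hB' rfl (by omega)
      exact ⟨k + 1, by omega, C, .step s hex k C (he ▸ hC), hsol⟩
    · have hneg : ∀ e, s.circuit e ≠ -1 := by
        intro e he
        cases e with
        | none => rw [hX.2.2] at he; exact absurd he (by decide)
        | some e => exact hex ⟨e, he⟩
      exact ⟨0, Nat.zero_le _, _, .halt s hneg, isSolution_of_isFundamentalCircuit ht hX hneg⟩

end Extension

end ComplementedSet

/-! ### Closure under pivot transforms and the linear bound -/

theorem mainTheorem3 {E : Type*} [Finite E] {n : ℕ} (G : ComplementedSet E n) :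
    (∀ M : OrientedMatroid E,
      G.IsKStarMatroid M ↔ G.PrincipalPivotClosure G.IsKMatroid M) ∧
    (∀ (M : OrientedMatroid E) (Mhat : OrientedMatroid (Option E)),
      G.IsKStarMatroid M → Mhat.IsOnePointExtension M →
      ∀ B₀ : Set E, G.IsComplementary B₀ → Mhat.IsBasis (some '' B₀) →
      ∀ R : PivotRule E,
        ∃ k ≤ 2 * n, ∃ C : SignVec (Option E),
          G.Returns Mhat R (ComplementedSet.initState Mhat B₀) k C ∧
          G.IsSolution Mhat C ∧
          ∀ X, G.IsSolution Mhat X → X = C) := by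
  refine ⟨ComplementedSet.isKStarMatroid_iff_principalPivotClosure, ?_⟩
  rintro M Mhat ⟨hP, -, S', hc, hn, hZ⟩ hM B₀ hB₀c hB₀ R
  have hS' := G.isTransversal_of_ncard hc hn
  have hT' : ∀ f, f ∈ (Set.toFinite (G.compl '' S')).toFinset ↔ f ∉ S' := by
    intro f
    rw [Set.Finite.mem_toFinset, ← hS' f]
    exact ⟨fun ⟨g, hg, h⟩ => by rwa [← h, G.compl_compl], fun h => ⟨_, h, G.compl_compl f⟩⟩
  have hcard : (Set.toFinite (G.compl '' S')).toFinset.card = n := by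
    rw [← Set.ncard_eq_toFinset_card, Set.ncard_image_of_injective _ G.compl_injective, hn]
  obtain ⟨k, hk, C, hC, hsol⟩ := hP.exists_returns hM hS' hZ R _ hT' (2 * n)
    (ComplementedSet.initState Mhat B₀)
    (hP.isTransversal_of_isBasis_extension hM hB₀c hB₀) hB₀ rfl (by
      -- There are `n` pairs, each of potential at most 2 at the start.
      refine (Finset.sum_le_card_nsmul _ _ 2 fun f _ => ?_).trans (by rw [hcard]; simp [mul_comm])
      unfold ComplementedSet.pairPotential
      split_ifs <;> decide)
  exact ⟨k, hk, C, hC, hsol, fun X hX => hX.eq hP hM hsol⟩
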